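/- For $n\ge 1$, let $\{a_{i,j}\}_{1\le i,j\le n}$ be any real numbers, let $\Pi_n$ be a uniformly distributed random permutation of $\{1,\dots,n\}$, and let $Z_n=\sum_{i=1}^n a_{i,\Pi_n(i)}$. Put $$d_{i,j}=a_{i,j}-\frac1n\sum_{k=1}^n a_{k,j}-\frac1n\sum_{l=1}^n a_{i,l}+\frac1{n^2}\sum_{k,l=1}^n a_{k,l}.$$ 1. For all $t>0$, $$\mathbb P\bigl(|Z_n-\mathbb E[Z_n]|\ge t\bigr)\le 16\,e^{1/16}\exp\!\left(\frac{-t^2}{256\left(\operatorname{Var}(Z_n)+\max_{1\le i,j\le n}|a_{i,j}|\;t\right)}\right),$$ where, if $\operatorname{Var}(Z_n)=\max_{i,j}|a_{i,j}|=0$, the exponent is read as $0$. 2. If $n\ge 2$, then $\operatorname{Var}(Z_n)=\frac1{n-1}\sum_{i,j=1}^n d_{i,j}^2$. 3. Suppose that for each $n$ such an array $a=a^{(n)}$ is given, with associated $d=d^{(n)}$ and $Z_n$, that for all sufficiently large $n$ at least one $d^{(n)}_{i,j}$ is nonzero, and that Hoeffding's condition $$\frac{\max_{1\le i,j\le n}|d^{(n)}_{i,j}|}{\sqrt{\frac1n\sum_{i,j=1}^n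 (d^{(n)}_{i,j})^2}}\;\xrightarrow[n\to\infty]{}\;0$$ holds. Then for all $x>0$, $$\limsup_{n\to\infty}\ \mathbb P\Bigl(|Z_n-\mathbb E[Z_n]|\ge x\sqrt{\operatorname{Var}(Z_n)}\Bigr)\le 16\,e^{1/16}\,e^{-x^2/256}.$$ -/

import Mathlib

open MeasureTheory ProbabilityTheory Filter Topology

/-- `P` is a random permutation of an `n`-element set, uniformly distributed under `μ`: each of the
`n!` permutations is taken with probability `1 / n!`.
(In particular `μ` is then a probability measure.) -/
structure IsUniformPerm {Ω : Type*} [MeasurableSpace Ω] (μ : Measure Ω) {n : ℕ}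
    (P : Ω → Equiv.Perm (Fin n)) : Prop where
  measurableSet_eq : ∀ σ : Equiv.Perm (Fin n), MeasurableSet {ω | P ω = σ}
  measure_eq : ∀ σ : Equiv.Perm (Fin n), μ {ω | P ω = σ} = ((n.factorial : ℕ) : ENNReal)⁻¹

/-- The randomly permuted sum `Z = ∑ i, a_{i, P(i)}`. -/
def permSum {Ω : Type*} {n : ℕ} (a : Fin n → Fin n → ℝ) (P : Ω → Equiv.Perm (Fin n)) (ω : Ω) : ℝ :=
  ∑ i, a i (P ω i)

/-- `max_{i,j} |a_{i,j}|`: for `n ≥ 1` a supremum over a finite nonempty family. -/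
noncomputable def maxAbs {n : ℕ} (a : Fin n → Fin n → ℝ) : ℝ :=
  ⨆ p : Fin n × Fin n, |a p.1 p.2|

/-- Hoeffding's doubly centred entries `d_{i,j}`. -/
noncomputable def centred {n : ℕ} (a : Fin n → Fin n → ℝ) (i j : Fin n) : ℝ :=
  a i j - (1 / (n : ℝ)) * ∑ k, a k j - (1 / (n : ℝ)) * ∑ l, a i l
    + (1 / (n : ℝ) ^ 2) * ∑ k, ∑ l, a k l

/-- Hoeffding's condition on a sequence of square arrays, the `n`-th being of size `n × n`:
`max_{i,j} |d_{i,j}| / √(n⁻¹ ∑_{i,j} d_{i,j}²) → 0`. The quotient is required to be meaningful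
(positive denominator) for all large `n`. -/
def HoeffdingCondition (a : (n : ℕ) → Fin n → Fin n → ℝ) : Prop :=
  (∀ᶠ n in atTop, 0 < ∑ i, ∑ j, centred (a n) i j ^ 2) ∧
  Tendsto (fun n : ℕ => maxAbs (centred (a n)) /
    Real.sqrt ((1 / (n : ℝ)) * ∑ i, ∑ j, centred (a n) i j ^ 2)) atTop (𝓝 0)

/-! The method is that of exchangeable pairs. Let W(σ) = ∑ d i (σ i) with d centred, and let W' be
its value at σ composed with a transposition (i j), which is again uniform when σ is. Then W - W' is
a mixed second difference, and its sum over all (i, j) is 2nW, so 4n E[W f] = ∑ E[(W - W')(f - f')]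
(`sum_diagSum_mul`).

With f = exp(θW), this gives M'(θ) ≤ 16 θ S M(θ) for the moment generating function M, where S = ∑
d² / n, as long as Dθ ≤ 1 for a bound D on the mixed differences (`sum_diagSum_mul_exp_le`).
Integrating gives M ≤ exp(8Sθ²), and since S ≤ Var Z, Chernoff's bound yields the tail. Mixed
differences do not change under centring, so D may come from max |a| (the inequality) or from max
|d| (the limit). -/

/-- The sum `∑ i, d i (σ i)` along a permutation. -/
def diagSum {ι : Type*} [Fintype ι] (d : ι → ι → ℝ) (σ : Equiv.Perm ι) : ℝ := ∑ i, d i (σ i)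

/-- The mixed second difference of `d` on the rows `i, j` and the columns `k, l`. -/
def mixedDiff {ι : Type*} (d : ι → ι → ℝ) (i j k l : ι) : ℝ := d i k + d j l - d i l - d j k

/-! ### Transposition identities and the second moment. -/

section DiagSum

variable {ι : Type*} [Fintype ι] [DecidableEq ι] {d : ι → ι → ℝ}

theorem diagSum_sub_mul_swap (d : ι → ι → ℝ) (σ : Equiv.Perm ι) (i j : ι) :
    diagSum d σ - diagSum d (σ * Equiv.swap i j) = mixedDiff d i j (σ i) (σ j) := by
  rcases eq_or_ne i j with rfl | hij
  · have : (σ * Equiv.swap i i) = σ := by rw [Equiv.swap_self]; exact mul_one σ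
    simp only [this, mixedDiff]; ring
  · unfold diagSum
    rw [← Finset.sum_sub_distrib, ← Finset.sum_subset (Finset.subset_univ ({i, j} : Finset ι)),
      Finset.sum_pair hij]
    · simp [mixedDiff]; ring
    · intro k _ hk
      simp only [Finset.mem_insert, Finset.mem_singleton, not_or] at hk
      simp [Equiv.swap_apply_of_ne_of_ne hk.1 hk.2]

theorem sum_perm_mul_swap (f : Equiv.Perm ι → ℝ) (i j : ι) :
    ∑ σ, f (σ * Equiv.swap i j) = ∑ σ, f σ :=
  Equiv.sum_comp (Equiv.mulRight (Equiv.swap i j)) f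

theorem sum_row_perm {ι : Type*} [Fintype ι] {d : ι → ι → ℝ} (hr : ∀ i, ∑ j, d i j = 0) (i : ι) (σ : Equiv.Perm ι) :
    ∑ j, d i (σ j) = 0 := by
  rw [Equiv.sum_comp σ (d i), hr]

/-- The linear regression property of the exchangeable pair: the off-diagonal terms are row sums and
vanish. -/
theorem sum_mixedDiff {ι : Type*} [Fintype ι] {d : ι → ι → ℝ} (hr : ∀ i, ∑ j, d i j = 0) (σ : Equiv.Perm ι) :
    ∑ i, ∑ j, mixedDiff d i j (σ i) (σ j) = 2 * Fintype.card ι * diagSum d σ := by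
  have h : ∑ i, ∑ j, d j (σ i) = 0 := by
    rw [Finset.sum_comm]; simp [sum_row_perm hr]
  simp only [mixedDiff, Finset.sum_add_distrib, Finset.sum_sub_distrib, h, sum_row_perm hr,
    Finset.sum_const, Finset.card_univ, nsmul_eq_mul, ← Finset.mul_sum, diagSum]
  simp; ring

/-- The regression property gives W as a sum of W - W'. This difference changes sign under the swap,
so the sum against f can be antisymmetrised at the cost of a factor 2. -/
theorem sum_diagSum_mul (hr : ∀ i, ∑ j, d i j = 0) (f : Equiv.Perm ι → ℝ) :
    4 * Fintype.card ι * ∑ σ, diagSum d σ * f σ =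
      ∑ i, ∑ j, ∑ σ, (diagSum d σ - diagSum d (σ * Equiv.swap i j)) *
        (f σ - f (σ * Equiv.swap i j)) := by
  have h1 : ∑ i, ∑ j, ∑ σ, (diagSum d σ - diagSum d (σ * Equiv.swap i j)) * f σ =
      2 * Fintype.card ι * ∑ σ, diagSum d σ * f σ := by
    simp only [diagSum_sub_mul_swap]
    calc _ = ∑ σ, (∑ i, ∑ j, mixedDiff d i j (σ i) (σ j)) * f σ := by
          simp only [Finset.sum_mul]
          rw [Finset.sum_comm]
          simp_rw [Finset.sum_comm (s := (Finset.univ : Finset ι))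
            (t := (Finset.univ : Finset (Equiv.Perm ι)))]
          refine Finset.sum_congr rfl fun σ _ => Finset.sum_comm
      _ = _ := by
          simp only [sum_mixedDiff hr, Finset.mul_sum]
          exact Finset.sum_congr rfl fun σ _ => by ring
  have h2 (i j : ι) : ∑ σ, (diagSum d σ - diagSum d (σ * Equiv.swap i j)) *
        (f σ - f (σ * Equiv.swap i j)) =
      2 * ∑ σ, (diagSum d σ - diagSum d (σ * Equiv.swap i j)) * f σ := by
    have := sum_perm_mul_swap
      (fun σ => (diagSum d σ - diagSum d (σ * Equiv.swap i j)) * f (σ * Equiv.swap i j)) i j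
    simp only [mul_assoc, Equiv.swap_mul_self, mul_one] at this
    rw [Finset.sum_congr rfl fun σ _ => mul_sub _ _ _, Finset.sum_sub_distrib, ← this]
    simp only [sub_mul, mul_sub, Finset.sum_sub_distrib]
    ring
  simp only [h2, ← Finset.mul_sum, h1]
  ring

theorem sum_diagSum (hr : ∀ i, ∑ j, d i j = 0) : ∑ σ, diagSum d σ = 0 := by
  rcases isEmpty_or_nonempty ι with h | h
  · simp [diagSum]
  · have := sum_diagSum_mul hr (fun _ => 1)
    simpa using this

/-- The second moment of a doubly centred permuted sum. -/
theorem sum_diagSum_sq (hr : ∀ i, ∑ j, d i j = 0) (hc : ∀ j, ∑ i, d i j = 0) :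
    ((Fintype.card ι : ℝ) - 1) * ∑ σ, diagSum d σ ^ 2 =
      Fintype.card (Equiv.Perm ι) * ∑ i, ∑ j, d i j ^ 2 := by
  -- Substituting σ * (i j) for σ in each term of n ∑ W² gives the left side (`h1`). Row and column
  -- sums kill all but the squares and a cross term, and undoing the swap in the cross term gives ∑
  -- W² back (`h2`), whence the factor n - 1.
  have key (σ : Equiv.Perm ι) : ∑ i, ∑ j, d i (σ j) * diagSum d (σ * Equiv.swap i j) =
      ∑ i, ∑ j, d i j ^ 2 + ∑ i, ∑ j, d i (σ j) * d j (σ i) := by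
    have e (i j : ι) : d i (σ j) * diagSum d (σ * Equiv.swap i j) =
        d i (σ j) * (diagSum d σ - d i (σ i)) - d i (σ j) * d j (σ j) + d i (σ j) ^ 2
          + d i (σ j) * d j (σ i) := by
      have := diagSum_sub_mul_swap d σ i j
      rw [show diagSum d (σ * Equiv.swap i j) = diagSum d σ - mixedDiff d i j (σ i) (σ j) by
        linarith, mixedDiff]
      ring
    have z : ∑ i, ∑ j, d i (σ j) * d j (σ j) = 0 := by
      rw [Finset.sum_comm]; simp [← Finset.sum_mul, hc]
    have q (i : ι) : ∑ j, d i (σ j) ^ 2 = ∑ j, d i j ^ 2 := Equiv.sum_comp σ (fun j => d i j ^ 2)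
    simp only [e, Finset.sum_add_distrib, Finset.sum_sub_distrib, ← Finset.sum_mul,
      sum_row_perm hr, q, z]
    simp
  have h1 : Fintype.card ι * ∑ σ, diagSum d σ ^ 2 =
      ∑ σ, ∑ i, ∑ j, d i (σ j) * diagSum d (σ * Equiv.swap i j) := by
    rw [Finset.sum_comm]
    simp_rw [Finset.sum_comm (s := (Finset.univ : Finset (Equiv.Perm ι)))]
    have (i j : ι) : ∑ σ : Equiv.Perm ι, d i (σ j) * diagSum d (σ * Equiv.swap i j) =
        ∑ σ, d i (σ i) * diagSum d σ := by
      rw [← sum_perm_mul_swap (fun σ => d i (σ i) * diagSum d σ) i j]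
      simp
    simp only [this, Finset.sum_const, Finset.card_univ, nsmul_eq_mul, ← Finset.mul_sum]
    rw [Finset.sum_comm]
    simp only [← Finset.sum_mul, sq]
    rfl
  have h2 : ∑ σ : Equiv.Perm ι, ∑ i, ∑ j, d i (σ j) * d j (σ i) = ∑ σ, diagSum d σ ^ 2 := by
    rw [Finset.sum_comm]
    simp_rw [Finset.sum_comm (s := (Finset.univ : Finset (Equiv.Perm ι)))]
    have (i j : ι) : ∑ σ : Equiv.Perm ι, d i (σ j) * d j (σ i) =
        ∑ σ : Equiv.Perm ι, d i (σ i) * d j (σ j) := by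
      rw [← sum_perm_mul_swap (fun σ => d i (σ i) * d j (σ j)) i j]
      simp
    simp only [this, sq, diagSum, Finset.sum_mul_sum]
    simp_rw [Finset.sum_comm (t := (Finset.univ : Finset (Equiv.Perm ι)))]
  simp only [key, Finset.sum_add_distrib, h2, Finset.sum_const, Finset.card_univ,
    nsmul_eq_mul] at h1
  linarith

/-! ### The moment generating function. -/

/-- A swap of i and j costs at most a factor exp(Dθ) in the weight and replaces σ i by σ j. Summing
over j then turns d i (σ i)² into a full row sum, independent of σ. -/
theorem sum_sq_mul_exp_diagSum_le {D θ : ℝ} (hD : ∀ i j k l, |mixedDiff d i j k l| ≤ D)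
    (hθ : 0 ≤ θ) :
    Fintype.card ι * ∑ σ, (∑ i, d i (σ i) ^ 2) * Real.exp (θ * diagSum d σ) ≤
      Real.exp (D * θ) * (∑ i, ∑ j, d i j ^ 2) * ∑ σ, Real.exp (θ * diagSum d σ) := by
  have h1 (i j : ι) : ∑ σ, d i (σ i) ^ 2 * Real.exp (θ * diagSum d σ) ≤
      Real.exp (D * θ) * ∑ σ, d i (σ j) ^ 2 * Real.exp (θ * diagSum d σ) := by
    rw [← sum_perm_mul_swap (fun σ => d i (σ i) ^ 2 * Real.exp (θ * diagSum d σ)) i j,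
      Finset.mul_sum]
    refine Finset.sum_le_sum fun σ _ => ?_
    have e := diagSum_sub_mul_swap d σ i j
    have b := (abs_le.1 (hD i j (σ i) (σ j))).1
    have : Real.exp (θ * diagSum d (σ * Equiv.swap i j)) ≤
        Real.exp (D * θ) * Real.exp (θ * diagSum d σ) := by
      rw [← Real.exp_add]
      refine Real.exp_le_exp.2 ?_
      nlinarith
    simp only [Equiv.Perm.mul_apply, Equiv.swap_apply_left]
    calc _ ≤ d i (σ j) ^ 2 * (Real.exp (D * θ) * Real.exp (θ * diagSum d σ)) := by gcongr
      _ = _ := by ring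
  have h2 (i : ι) : Fintype.card ι * ∑ σ, d i (σ i) ^ 2 * Real.exp (θ * diagSum d σ) ≤
      Real.exp (D * θ) * (∑ j, d i j ^ 2) * ∑ σ, Real.exp (θ * diagSum d σ) := by
    calc _ = ∑ _j : ι, ∑ σ, d i (σ i) ^ 2 * Real.exp (θ * diagSum d σ) := by simp
      _ ≤ ∑ j, Real.exp (D * θ) * ∑ σ, d i (σ j) ^ 2 * Real.exp (θ * diagSum d σ) :=
        Finset.sum_le_sum fun j _ => h1 i j
      _ = _ := by
        have q (σ : Equiv.Perm ι) : ∑ j, d i (σ j) ^ 2 = ∑ j, d i j ^ 2 :=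
          Equiv.sum_comp σ (fun j => d i j ^ 2)
        rw [← Finset.mul_sum, Finset.sum_comm, mul_assoc]
        simp only [← Finset.sum_mul, q, ← Finset.mul_sum]
  calc _ = ∑ i, Fintype.card ι * ∑ σ, d i (σ i) ^ 2 * Real.exp (θ * diagSum d σ) := by
        rw [← Finset.mul_sum, Finset.sum_comm]
        simp only [Finset.sum_mul]
    _ ≤ _ := by
        refine (Finset.sum_le_sum fun i _ => h2 i).trans_eq ?_
        rw [← Finset.sum_mul, ← Finset.mul_sum]

/-- The tangent-line bound at the larger point; keeping both exponentials makes the right side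
symmetric under exchange. -/
theorem sub_mul_exp_sub_exp_le {θ : ℝ} (hθ : 0 ≤ θ) (x y : ℝ) :
    (x - y) * (Real.exp (θ * x) - Real.exp (θ * y)) ≤
      θ * ((x - y) ^ 2 * Real.exp (θ * x) + (x - y) ^ 2 * Real.exp (θ * y)) := by
  have aux (u v : ℝ) : Real.exp u - Real.exp v ≤ (u - v) * Real.exp u := by
    have h := Real.add_one_le_exp (v - u)
    have : Real.exp v = Real.exp (v - u) * Real.exp u := by rw [← Real.exp_add]; ring_nf
    nlinarith [Real.exp_pos u]
  have p := mul_nonneg hθ (mul_nonneg (sq_nonneg (x - y)) (Real.exp_pos (θ * x)).le)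
  have q := mul_nonneg hθ (mul_nonneg (sq_nonneg (x - y)) (Real.exp_pos (θ * y)).le)
  rcases le_total y x with h | h
  · have := mul_le_mul_of_nonneg_left (aux (θ * x) (θ * y)) (sub_nonneg.2 h)
    nlinarith
  · have := mul_le_mul_of_nonneg_left (aux (θ * y) (θ * x)) (sub_nonneg.2 h)
    nlinarith

theorem sum_diagSum_mul_exp_le {D θ : ℝ} (hr : ∀ i, ∑ j, d i j = 0)
    (hD : ∀ i j k l, |mixedDiff d i j k l| ≤ D) (hθ : 0 ≤ θ) (hDθ : D * θ ≤ 1) :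
    Fintype.card ι * ∑ σ, diagSum d σ * Real.exp (θ * diagSum d σ) ≤
      16 * θ * (∑ i, ∑ j, d i j ^ 2) * ∑ σ, Real.exp (θ * diagSum d σ) := by
  set E : Equiv.Perm ι → ℝ := fun σ => Real.exp (θ * diagSum d σ) with hE
  have hE0 (σ : Equiv.Perm ι) : 0 ≤ E σ := (Real.exp_pos _).le
  have step1 (i j : ι) : ∑ σ, (diagSum d σ - diagSum d (σ * Equiv.swap i j)) *
      (E σ - E (σ * Equiv.swap i j)) ≤
        2 * θ * ∑ σ, (mixedDiff d i j (σ i) (σ j)) ^ 2 * E σ := by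
    have := sum_perm_mul_swap
      (fun σ => (diagSum d σ - diagSum d (σ * Equiv.swap i j)) ^ 2 * E (σ * Equiv.swap i j)) i j
    simp only [mul_assoc, Equiv.swap_mul_self, mul_one] at this
    calc _ ≤ ∑ σ, θ * ((diagSum d σ - diagSum d (σ * Equiv.swap i j)) ^ 2 * E σ +
          (diagSum d σ - diagSum d (σ * Equiv.swap i j)) ^ 2 * E (σ * Equiv.swap i j)) :=
        Finset.sum_le_sum fun σ _ => sub_mul_exp_sub_exp_le hθ _ _
      _ = _ := by
        rw [← Finset.mul_sum, Finset.sum_add_distrib, ← this]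
        simp only [← diagSum_sub_mul_swap]
        rw [Finset.sum_congr rfl fun σ _ => by rw [← neg_sub, neg_sq]]
        ring
  have step2 (σ : Equiv.Perm ι) : ∑ i, ∑ j, (mixedDiff d i j (σ i) (σ j)) ^ 2 ≤
      8 * (Fintype.card ι * ∑ i, d i (σ i) ^ 2 + ∑ i, ∑ j, d i j ^ 2) := by
    have q (i : ι) : ∑ j, d i (σ j) ^ 2 = ∑ j, d i j ^ 2 := Equiv.sum_comp σ (fun j => d i j ^ 2)
    have q' : ∑ i, ∑ j, d j (σ i) ^ 2 = ∑ i, ∑ j, d i j ^ 2 := by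
      rw [Finset.sum_comm]; simp only [q]
    calc _ ≤ ∑ i, ∑ j, 4 * (d i (σ i) ^ 2 + d j (σ j) ^ 2 + d i (σ j) ^ 2 + d j (σ i) ^ 2) := by
          refine Finset.sum_le_sum fun i _ => Finset.sum_le_sum fun j _ => ?_
          unfold mixedDiff
          nlinarith [sq_nonneg (d i (σ i) - d j (σ j)), sq_nonneg (d i (σ i) + d i (σ j)),
            sq_nonneg (d i (σ i) + d j (σ i)), sq_nonneg (d j (σ j) + d i (σ j)),
            sq_nonneg (d j (σ j) + d j (σ i)), sq_nonneg (d i (σ j) - d j (σ i))]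
      _ = _ := by
          simp only [← Finset.mul_sum, Finset.sum_add_distrib, q, q', Finset.sum_const,
            Finset.card_univ, nsmul_eq_mul]
          ring
  have step3 : 4 * Fintype.card ι * ∑ σ, diagSum d σ * E σ ≤
      2 * θ * ∑ σ, (∑ i, ∑ j, (mixedDiff d i j (σ i) (σ j)) ^ 2) * E σ := by
    rw [sum_diagSum_mul hr]
    refine (Finset.sum_le_sum fun i _ => Finset.sum_le_sum fun j _ => step1 i j).trans_eq ?_
    simp only [← Finset.mul_sum, Finset.sum_mul]
    congr 1
    simp_rw [Finset.sum_comm (s := (Finset.univ : Finset ι))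
            (t := (Finset.univ : Finset (Equiv.Perm ι)))]
  have step4 : ∑ σ, (∑ i, ∑ j, (mixedDiff d i j (σ i) (σ j)) ^ 2) * E σ ≤
      8 * (Real.exp (D * θ) + 1) * (∑ i, ∑ j, d i j ^ 2) * ∑ σ, E σ := by
    have := sum_sq_mul_exp_diagSum_le hD hθ
    calc _ ≤ ∑ σ, 8 * (Fintype.card ι * ∑ i, d i (σ i) ^ 2 + ∑ i, ∑ j, d i j ^ 2) * E σ :=
          Finset.sum_le_sum fun σ _ => mul_le_mul_of_nonneg_right (step2 σ) (hE0 σ)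
      _ = 8 * (Fintype.card ι * ∑ σ, (∑ i, d i (σ i) ^ 2) * E σ) +
            8 * (∑ i, ∑ j, d i j ^ 2) * ∑ σ, E σ := by
          simp only [Finset.mul_sum (s := (Finset.univ : Finset (Equiv.Perm ι))),
            ← Finset.sum_add_distrib]
          exact Finset.sum_congr rfl fun σ _ => by ring
      _ ≤ _ := by linarith
  -- Here Dθ ≤ 1 enters: 8(e + 1) ≤ 32, and 2 * 32 / 4 = 16 is the final constant.
  have hexp : Real.exp (D * θ) ≤ 3 :=
    (Real.exp_le_exp.2 hDθ).trans (Real.exp_one_lt_d9.le.trans (by norm_num))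
  have hS : 0 ≤ ∑ i, ∑ j, d i j ^ 2 := by positivity
  have hM : 0 ≤ ∑ σ, E σ := Finset.sum_nonneg fun σ _ => hE0 σ
  have step5 : 8 * (Real.exp (D * θ) + 1) * (∑ i, ∑ j, d i j ^ 2) * ∑ σ, E σ ≤
      32 * (∑ i, ∑ j, d i j ^ 2) * ∑ σ, E σ := by
    gcongr; linarith
  have := mul_le_mul_of_nonneg_left (step4.trans step5) (mul_nonneg two_pos.le hθ)
  linarith

/-- A sub-Gaussian bound near `0` for the moment generating function of a centred permuted sum. -/
theorem sum_exp_diagSum_le [Nonempty ι] {D θ : ℝ} (hr : ∀ i, ∑ j, d i j = 0)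
    (hD : ∀ i j k l, |mixedDiff d i j k l| ≤ D) (hθ : 0 ≤ θ) (hDθ : D * θ ≤ 1) :
    ∑ σ, Real.exp (θ * diagSum d σ) ≤
      Fintype.card (Equiv.Perm ι) *
        Real.exp (8 * ((∑ i, ∑ j, d i j ^ 2) / Fintype.card ι) * θ ^ 2) := by
  set S := (∑ i, ∑ j, d i j ^ 2) / (Fintype.card ι : ℝ) with hS
  have hn : (0 : ℝ) < Fintype.card ι := by exact_mod_cast Fintype.card_pos
  have hD0 : 0 ≤ D := (abs_nonneg _).trans (hD (Classical.arbitrary ι) (Classical.arbitrary ι)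
    (Classical.arbitrary ι) (Classical.arbitrary ι))
  -- Integrating factor for M' ≤ 16 S s M: `g` is antitone on [0, θ].
  let g : ℝ → ℝ := fun s => (∑ σ, Real.exp (s * diagSum d σ)) * Real.exp (-(8 * S * s ^ 2))
  have hg (s : ℝ) : HasDerivAt g
      ((∑ σ, diagSum d σ * Real.exp (s * diagSum d σ)) * Real.exp (-(8 * S * s ^ 2)) +
        (∑ σ, Real.exp (s * diagSum d σ)) *
          (Real.exp (-(8 * S * s ^ 2)) * (-(16 * S * s)))) s := by
    refine HasDerivAt.mul ?_ ?_
    · refine HasDerivAt.fun_sum fun σ _ => ?_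
      have := ((hasDerivAt_id s).mul_const (diagSum d σ)).exp
      simpa [mul_comm] using this
    · have := (((hasDerivAt_pow 2 s).const_mul (8 * S)).neg).exp
      refine this.congr_deriv ?_
      simp; ring
  have hanti : AntitoneOn g (Set.Icc 0 θ) := by
    refine antitoneOn_of_deriv_nonpos (convex_Icc 0 θ)
      (fun s _ => (hg s).continuousAt.continuousWithinAt)
      (fun s _ => (hg s).differentiableAt.differentiableWithinAt) fun s hs => ?_
    rw [interior_Icc] at hs
    rw [(hg s).deriv]
    have h := sum_diagSum_mul_exp_le hr hD hs.1.le
      ((mul_le_mul_of_nonneg_left hs.2.le hD0).trans hDθ)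
    have h' : ∑ σ, diagSum d σ * Real.exp (s * diagSum d σ) ≤
        16 * s * S * ∑ σ, Real.exp (s * diagSum d σ) := by
      rw [← mul_le_mul_iff_right₀ hn]
      refine h.trans_eq ?_
      rw [hS]; field_simp
    nlinarith [Real.exp_pos (-(8 * S * s ^ 2))]
  have h := hanti (Set.left_mem_Icc.2 hθ) (Set.right_mem_Icc.2 hθ) hθ
  simp only [g, zero_mul, Real.exp_zero, Finset.sum_const, Finset.card_univ, nsmul_eq_mul,
    Real.exp_neg] at h
  rw [← div_eq_mul_inv, div_le_iff₀ (Real.exp_pos _)] at h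
  simpa using h

end DiagSum

/-! ### Expectations under a uniform permutation. -/

namespace IsUniformPerm

variable {Ω : Type*} [MeasurableSpace Ω] {μ : Measure Ω} {n : ℕ} {P : Ω → Equiv.Perm (Fin n)}

theorem measurable_comp (h : IsUniformPerm μ P) (f : Equiv.Perm (Fin n) → ℝ) :
    Measurable fun ω => f (P ω) := by
  let _ : MeasurableSpace (Equiv.Perm (Fin n)) := ⊤
  have hP : Measurable P := measurable_to_countable' h.measurableSet_eq
  exact measurable_from_top.comp hP

theorem memLp_comp [IsProbabilityMeasure μ] (h : IsUniformPerm μ P)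
    (f : Equiv.Perm (Fin n) → ℝ) (p : ENNReal) : MemLp (fun ω => f (P ω)) p μ :=
  MemLp.of_bound (h.measurable_comp f).aestronglyMeasurable (∑ σ, ‖f σ‖) <|
    ae_of_all _ fun ω => Finset.single_le_sum (f := fun σ => ‖f σ‖)
      (fun _ _ => norm_nonneg _) (Finset.mem_univ (P ω))

theorem integral_comp [IsProbabilityMeasure μ] (h : IsUniformPerm μ P)
    (f : Equiv.Perm (Fin n) → ℝ) :
    ∫ ω, f (P ω) ∂μ = (n.factorial : ℝ)⁻¹ * ∑ σ, f σ := by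
  let _ : MeasurableSpace (Equiv.Perm (Fin n)) := ⊤
  have hP : Measurable P := measurable_to_countable' h.measurableSet_eq
  have : IsProbabilityMeasure (μ.map P) := Measure.isProbabilityMeasure_map hP.aemeasurable
  have hf : Measurable f := measurable_from_top
  have hint : Integrable f (μ.map P) := Integrable.of_finite
  rw [← integral_map hP.aemeasurable hf.aestronglyMeasurable, integral_fintype hint, Finset.mul_sum]
  refine Finset.sum_congr rfl fun σ _ => ?_
  have : μ (P ⁻¹' {σ}) = ((n.factorial : ℕ) : ENNReal)⁻¹ := h.measure_eq σ
  rw [map_measureReal_apply hP (measurableSet_singleton σ), measureReal_def, this]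
  simp

end IsUniformPerm

/-! ### Double centring. -/

section Centred

variable {n : ℕ} (a : Fin n → Fin n → ℝ)

theorem sum_centred_row (i : Fin n) : ∑ j, centred a i j = 0 := by
  have hn : (n : ℝ) ≠ 0 := by exact_mod_cast (Fin.pos i).ne'
  simp only [centred, Finset.sum_add_distrib, Finset.sum_sub_distrib, Finset.sum_const,
    Finset.card_univ, Fintype.card_fin, nsmul_eq_mul, ← Finset.mul_sum]
  rw [Finset.sum_comm (f := fun j k => a k j)]
  field_simp
  ring

theorem sum_centred_col (j : Fin n) : ∑ i, centred a i j = 0 := by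
  have hn : (n : ℝ) ≠ 0 := by exact_mod_cast (Fin.pos j).ne'
  simp only [centred, Finset.sum_add_distrib, Finset.sum_sub_distrib, Finset.sum_const,
    Finset.card_univ, Fintype.card_fin, nsmul_eq_mul, ← Finset.mul_sum]
  field_simp
  ring

theorem diagSum_eq_centred_add (σ : Equiv.Perm (Fin n)) :
    diagSum a σ = diagSum (centred a) σ + 1 / (n : ℝ) * ∑ i, ∑ j, a i j := by
  rcases Nat.eq_zero_or_pos n with rfl | hn
  · simp [diagSum]
  have hn : (n : ℝ) ≠ 0 := by exact_mod_cast hn.ne'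
  have e : ∑ i, ∑ k, a k (σ i) = ∑ i, ∑ j, a i j := by
    rw [Equiv.sum_comp σ (fun j => ∑ k, a k j), Finset.sum_comm]
  simp only [diagSum, centred, Finset.sum_add_distrib, Finset.sum_sub_distrib, Finset.sum_const,
    Finset.card_univ, Fintype.card_fin, nsmul_eq_mul, ← Finset.mul_sum, e]
  field_simp
  ring

/-- Centring only adds a function of the row and a function of the column, and both cancel. -/
theorem mixedDiff_centred (i j k l : Fin n) :
    mixedDiff (centred a) i j k l = mixedDiff a i j k l := by
  simp only [mixedDiff, centred]; ring

theorem abs_le_maxAbs (i j : Fin n) : |a i j| ≤ maxAbs a :=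
  le_ciSup (f := fun p : Fin n × Fin n => |a p.1 p.2|) (Set.finite_range _).bddAbove (i, j)

theorem maxAbs_nonneg : 0 ≤ maxAbs a := Real.iSup_nonneg fun _ => abs_nonneg _

theorem abs_mixedDiff_le_maxAbs (i j k l : Fin n) : |mixedDiff a i j k l| ≤ 4 * maxAbs a := by
  have h1 := abs_le.1 (abs_le_maxAbs a i k)
  have h2 := abs_le.1 (abs_le_maxAbs a j l)
  have h3 := abs_le.1 (abs_le_maxAbs a i l)
  have h4 := abs_le.1 (abs_le_maxAbs a j k)
  unfold mixedDiff
  exact abs_le.2 ⟨by linarith, by linarith⟩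

end Centred

/-! ### Variance and tail bounds for the permuted sum. -/

section PermSum

variable {Ω : Type*} [MeasurableSpace Ω] {μ : Measure Ω} [IsProbabilityMeasure μ] {n : ℕ}
  {P : Ω → Equiv.Perm (Fin n)}

theorem integral_diagSum_centred (h : IsUniformPerm μ P) (a : Fin n → Fin n → ℝ) :
    ∫ ω, diagSum (centred a) (P ω) ∂μ = 0 := by
  rw [h.integral_comp, sum_diagSum (sum_centred_row a), mul_zero]

theorem integral_permSum (h : IsUniformPerm μ P) (a : Fin n → Fin n → ℝ) :
    ∫ ω, permSum a P ω ∂μ = 1 / (n : ℝ) * ∑ i, ∑ j, a i j := by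
  have e : permSum a P = fun ω => diagSum (centred a) (P ω) + 1 / (n : ℝ) * ∑ i, ∑ j, a i j :=
    funext fun ω => diagSum_eq_centred_add a (P ω)
  rw [e, integral_add ((h.memLp_comp _ 1).integrable le_rfl) (integrable_const _),
    integral_diagSum_centred h]
  simp

theorem permSum_sub_integral (h : IsUniformPerm μ P) (a : Fin n → Fin n → ℝ) (ω : Ω) :
    permSum a P ω - ∫ ω', permSum a P ω' ∂μ = diagSum (centred a) (P ω) := by
  rw [integral_permSum h]
  exact sub_eq_of_eq_add (diagSum_eq_centred_add a (P ω))

/-- Hoeffding's formula for the variance of a randomly permuted sum. -/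
theorem variance_permSum (h : IsUniformPerm μ P) (hn : 2 ≤ n) (a : Fin n → Fin n → ℝ) :
    variance (permSum a P) μ = ((n : ℝ) - 1)⁻¹ * ∑ i, ∑ j, centred a i j ^ 2 := by
  rw [variance_eq_integral (X := permSum a P) (h.measurable_comp (diagSum a)).aemeasurable]
  simp only [permSum_sub_integral h]
  rw [h.integral_comp (fun σ => diagSum (centred a) σ ^ 2)]
  have key := sum_diagSum_sq (sum_centred_row a) (sum_centred_col a)
  have hn' : (2 : ℝ) ≤ n := by exact_mod_cast hn
  have hf : (n.factorial : ℝ) ≠ 0 := by exact_mod_cast n.factorial_ne_zero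
  rw [Fintype.card_perm, Fintype.card_fin] at key
  rw [inv_mul_eq_div, inv_mul_eq_div, div_eq_div_iff hf (by linarith)]
  linarith

/-- Passes from the natural scale of the exponential bound to the variance, as 1/n ≤ 1/(n - 1); for
n < 2 the left side is zero. -/
theorem sum_sq_centred_div_le_variance (h : IsUniformPerm μ P) (a : Fin n → Fin n → ℝ) :
    (∑ i, ∑ j, centred a i j ^ 2) / n ≤ variance (permSum a P) μ := by
  rcases Nat.lt_or_ge n 2 with hn | hn
  · refine le_of_eq_of_le ?_ (variance_nonneg _ _)
    interval_cases n <;> simp [centred]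
  · have hn' : (2 : ℝ) ≤ n := by exact_mod_cast hn
    rw [variance_permSum h hn, inv_mul_eq_div]
    have : 0 ≤ ∑ i, ∑ j, centred a i j ^ 2 := by positivity
    gcongr <;> linarith

theorem measureReal_le_diagSum_le (h : IsUniformPerm μ P) (hn : 0 < n) {d : Fin n → Fin n → ℝ}
    {B V t : ℝ} (hr : ∀ i, ∑ j, d i j = 0) (hB0 : 0 ≤ B)
    (hB : ∀ i j k l, |mixedDiff d i j k l| ≤ 4 * B)
    (hV : (∑ i, ∑ j, d i j ^ 2) / n ≤ V) (hV0 : 0 ≤ V) (ht : 0 < t) :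
    μ.real {ω | t ≤ diagSum d (P ω)} ≤ Real.exp (-t ^ 2 / (256 * (V + B * t))) := by
  rcases (add_nonneg hV0 (mul_nonneg hB0 ht.le)).eq_or_lt with h0 | hpos
  -- Division by zero makes the exponent 0, so the bound is 1.
  · simp [← h0]
  have : Nonempty (Fin n) := ⟨⟨0, hn⟩⟩
  set W := V + B * t with hW
  -- θ = t / (16W) minimises -θt + 8Wθ². The minimum -t²/(32W) is 8 times the exponent needed.
  have hθ : 0 ≤ t / (16 * W) := by positivity
  have hBθ : 4 * B * (t / (16 * W)) ≤ 1 := by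
    rw [← mul_div_assoc, div_le_one (by positivity)]
    nlinarith [mul_nonneg hB0 ht.le]
  have hm := sum_exp_diagSum_le hr hB hθ hBθ
  rw [Fintype.card_perm, Fintype.card_fin] at hm
  have hf : (0 : ℝ) < n.factorial := by exact_mod_cast n.factorial_pos
  have hmgf : mgf (fun ω => diagSum d (P ω)) μ (t / (16 * W)) ≤
      Real.exp (8 * V * (t / (16 * W)) ^ 2) := by
    rw [mgf, h.integral_comp (fun σ => Real.exp (t / (16 * W) * diagSum d σ)), inv_mul_le_iff₀ hf]
    refine hm.trans ?_
    gcongr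
  refine (measure_ge_le_exp_mul_mgf t hθ ((h.memLp_comp
    (fun σ => Real.exp (t / (16 * W) * diagSum d σ)) 1).integrable le_rfl)).trans ?_
  refine (mul_le_mul_of_nonneg_left hmgf (Real.exp_pos _).le).trans ?_
  rw [← Real.exp_add]
  refine Real.exp_le_exp.2 ?_
  have hVW : V ≤ W := by nlinarith [mul_nonneg hB0 ht.le]
  have e1 : 8 * V * (t / (16 * W)) ^ 2 ≤ 8 * W * (t / (16 * W)) ^ 2 := by gcongr
  have e2 : -(t / (16 * W)) * t + 8 * W * (t / (16 * W)) ^ 2 = -(8 * (t ^ 2 / (256 * W))) := by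
    field_simp; ring
  have e3 : 0 ≤ t ^ 2 / (256 * W) := by positivity
  rw [neg_div]
  linarith

/-- A Bernstein inequality for randomly permuted sums, in terms of any bound `4 * B` on the mixed
differences of the array. -/
theorem measureReal_le_abs_permSum_sub_le (h : IsUniformPerm μ P) (hn : 0 < n)
    (a : Fin n → Fin n → ℝ) {B t : ℝ} (hB0 : 0 ≤ B)
    (hB : ∀ i j k l, |mixedDiff a i j k l| ≤ 4 * B) (ht : 0 < t) :
    μ.real {ω | t ≤ |permSum a P ω - ∫ ω', permSum a P ω' ∂μ|} ≤
      16 * Real.exp (1 / 16) *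
        Real.exp (-t ^ 2 / (256 * (variance (permSum a P) μ + B * t))) := by
  set V := variance (permSum a P) μ with hVdef
  have hV := sum_sq_centred_div_le_variance h a
  have hV0 : 0 ≤ V := variance_nonneg _ _
  have hup := measureReal_le_diagSum_le h hn (sum_centred_row a) hB0
    (by simpa only [mixedDiff_centred] using hB) hV hV0 ht
  have hlo := measureReal_le_diagSum_le h hn (d := fun i j => -centred a i j)
    (by simp [sum_centred_row]) hB0
    (fun i j k l => by
      rw [show mixedDiff (fun i j => -centred a i j) i j k l = -mixedDiff a i j k l by
        rw [← mixedDiff_centred a]; unfold mixedDiff; ring, abs_neg]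
      exact hB i j k l)
    (by simpa using hV) hV0 ht
  have hsub : {ω | t ≤ |permSum a P ω - ∫ ω', permSum a P ω' ∂μ|} ⊆
      {ω | t ≤ diagSum (centred a) (P ω)} ∪
        {ω | t ≤ diagSum (fun i j => -centred a i j) (P ω)} := by
    intro ω hω
    simp only [Set.mem_ofPred_eq, permSum_sub_integral h, le_abs] at hω
    simpa [diagSum] using hω
  -- The two one-sided tails cost only a factor 2, well below 16 exp(1/16).
  have hone : 1 ≤ Real.exp (1 / 16) := Real.one_le_exp (by norm_num)
  have hpos := Real.exp_pos (-t ^ 2 / (256 * (V + B * t)))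
  calc _ ≤ _ := (measureReal_mono hsub).trans (measureReal_union_le _ _)
    _ ≤ 2 * Real.exp (-t ^ 2 / (256 * (V + B * t))) := by linarith
    _ ≤ _ := by
      gcongr
      linarith

end PermSum

/-- The Gaussian tail bound for randomly permuted sums under Hoeffding's condition. -/
theorem limsup_measureReal_permSum_le {a : (n : ℕ) → Fin n → Fin n → ℝ}
    (ha : HoeffdingCondition a) {Ω : ℕ → Type*} [∀ n, MeasurableSpace (Ω n)]
    {μ : (n : ℕ) → Measure (Ω n)} [∀ n, IsProbabilityMeasure (μ n)]
    {P : (n : ℕ) → Ω n → Equiv.Perm (Fin n)} (h : ∀ n, IsUniformPerm (μ n) (P n))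
    {x : ℝ} (hx : 0 < x) :
    limsup (fun n : ℕ => (μ n).real
      {ω | x * Real.sqrt (variance (permSum (a n) (P n)) (μ n)) ≤
        |permSum (a n) (P n) ω - ∫ ω', permSum (a n) (P n) ω' ∂(μ n)|}) atTop ≤
      16 * Real.exp (1 / 16) * Real.exp (-x ^ 2 / 256) := by
  obtain ⟨hpos, hlim⟩ := ha
  set r : ℕ → ℝ := fun n => maxAbs (centred (a n)) /
    Real.sqrt ((1 / (n : ℝ)) * ∑ i, ∑ j, centred (a n) i j ^ 2) with hr
  have hbound : Tendsto (fun n => 16 * Real.exp (1 / 16) *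
      Real.exp (-x ^ 2 / (256 * (1 + r n * x)))) atTop
      (𝓝 (16 * Real.exp (1 / 16) * Real.exp (-x ^ 2 / 256))) := by
    have hden : Tendsto (fun n => 256 * (1 + r n * x)) atTop (𝓝 256) := by
      simpa using ((hlim.mul_const x).const_add 1).const_mul 256
    exact (Real.continuous_exp.continuousAt.tendsto.comp
      (tendsto_const_nhds.div hden (by norm_num))).const_mul _
  rw [← hbound.limsup_eq]
  refine limsup_le_limsup ?_ ?_ hbound.isBoundedUnder_le
  · filter_upwards [hpos, eventually_gt_atTop 0] with n hS hn
    have hn' : (0 : ℝ) < n := by exact_mod_cast hn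
    set V := variance (permSum (a n) (P n)) (μ n) with hV
    have hSV : (1 / (n : ℝ)) * ∑ i, ∑ j, centred (a n) i j ^ 2 ≤ V := by
      rw [one_div_mul_eq_div]; exact sum_sq_centred_div_le_variance (h n) (a n)
    have hS' : 0 < (1 / (n : ℝ)) * ∑ i, ∑ j, centred (a n) i j ^ 2 := by positivity
    have hV0 : 0 < V := hS'.trans_le hSV
    have hs : 0 < Real.sqrt V := Real.sqrt_pos.2 hV0
    have hM := maxAbs_nonneg (centred (a n))
    -- Taken with B = max |d| rather than max |a|: this is the quantity that Hoeffding's condition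
    -- controls.
    refine (measureReal_le_abs_permSum_sub_le (h n) hn (a n) hM
      (fun i j k l => by rw [← mixedDiff_centred]; exact abs_mixedDiff_le_maxAbs _ i j k l)
      (mul_pos hx hs)).trans ?_
    have hMr : maxAbs (centred (a n)) ≤ r n * Real.sqrt V := by
      calc _ = r n * Real.sqrt ((1 / (n : ℝ)) * ∑ i, ∑ j, centred (a n) i j ^ 2) :=
            (div_mul_cancel₀ _ (Real.sqrt_pos.2 hS').ne').symm
        _ ≤ _ := mul_le_mul_of_nonneg_left (Real.sqrt_le_sqrt hSV)
            (div_nonneg hM (Real.sqrt_nonneg _))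
    have hr0 : 0 ≤ r n := div_nonneg hM (Real.sqrt_nonneg _)
    have hVs : Real.sqrt V ^ 2 = V := Real.sq_sqrt hV0.le
    refine mul_le_mul_of_nonneg_left (Real.exp_le_exp.2 ?_) (by positivity)
    have e : -x ^ 2 / (256 * (1 + r n * x)) =
        -(x * Real.sqrt V) ^ 2 / (256 * (V + r n * Real.sqrt V * (x * Real.sqrt V))) := by
      rw [show V + r n * Real.sqrt V * (x * Real.sqrt V) = (1 + r n * x) * Real.sqrt V ^ 2 by
        linear_combination (-1 : ℝ) * hVs]
      field_simp
    rw [e, neg_div, neg_div, neg_le_neg_iff]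
    gcongr
  · exact IsBoundedUnder.isCoboundedUnder_le (isBoundedUnder_of ⟨0, fun n => measureReal_nonneg⟩)

theorem corollary2p2 :
    -- the concentration inequality
    (∀ (n : ℕ), 0 < n → ∀ (a : Fin n → Fin n → ℝ)
      (Ω : Type*) [MeasurableSpace Ω] (μ : Measure Ω) [IsProbabilityMeasure μ]
      (P : Ω → Equiv.Perm (Fin n)), IsUniformPerm μ P →
      ∀ t : ℝ, 0 < t →
        μ.real {ω | t ≤ |permSum a P ω - ∫ ω', permSum a P ω' ∂μ|} ≤
          16 * Real.exp (1 / 16) *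
            Real.exp (-t ^ 2 / (256 * (variance (permSum a P) μ + maxAbs a * t)))) ∧
    -- the variance identity
    (∀ (n : ℕ), 2 ≤ n → ∀ (a : Fin n → Fin n → ℝ)
      (Ω : Type*) [MeasurableSpace Ω] (μ : Measure Ω) [IsProbabilityMeasure μ]
      (P : Ω → Equiv.Perm (Fin n)), IsUniformPerm μ P →
        variance (permSum a P) μ = ((n : ℝ) - 1)⁻¹ * ∑ i, ∑ j, centred a i j ^ 2) ∧
    -- the Gaussian tail under Hoeffding's condition
    (∀ (a : (n : ℕ) → Fin n → Fin n → ℝ), HoeffdingCondition a →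
      ∀ (Ω : ℕ → Type*) [∀ n, MeasurableSpace (Ω n)] (μ : (n : ℕ) → Measure (Ω n))
      [∀ n, IsProbabilityMeasure (μ n)] (P : (n : ℕ) → Ω n → Equiv.Perm (Fin n)),
      (∀ n, IsUniformPerm (μ n) (P n)) →
      ∀ x : ℝ, 0 < x →
        limsup (fun n : ℕ => (μ n).real
          {ω | x * Real.sqrt (variance (permSum (a n) (P n)) (μ n)) ≤
            |permSum (a n) (P n) ω - ∫ ω', permSum (a n) (P n) ω' ∂(μ n)|}) atTop ≤
          16 * Real.exp (1 / 16) * Real.exp (-x ^ 2 / 256)) := by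
  refine ⟨fun n hn a Ω _ μ _ P h t ht => ?_, fun n hn a Ω _ μ _ P h => variance_permSum h hn a,
    fun a ha Ω _ μ _ P h x hx => limsup_measureReal_permSum_le ha h hx⟩
  exact measureReal_le_abs_permSum_sub_le h hn a (maxAbs_nonneg a) (abs_mixedDiff_le_maxAbs a) ht
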